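/- Let $R$ be a commutative ring. A formed space with boundary over $R$ is a triple $(M,\lambda,\partial)$, where $M$ is a finitely generated free $R$-module, $\lambda:M\otimes M\to R$ is an alternating bilinear form (so $\lambda(v,v)=0$ for all $v\in M$), and $\partial:M\to R$ is a linear map. An isomorphism of such triples is a linear isomorphism that preserves the form and the boundary map. Set $$(M_1,\lambda_1,\partial_1)\#(M_2,\lambda_2,\partial_2)=\Big(M_1\oplus M_2,\ \begin{pmatrix}\lambda_1&\partial_1^T\partial_2\\-\partial_2^T\partial_1&\lambda_2\end{pmatrix},\ \partial_1+\partial_2\Big)$$ and $X=(R,0,\mathrm{id})$; $X^{\#0}$ is the zero triple. The arc genus $g_X(M,\lambda,\partial)\in\mathbb N\cup\{\infty\}$ is the supremum of all $g\in\mathbb N$ such that $(M,\lambda,\partial)\cong N\#X^{\#g}$ for some formed space with boundary $N$ (a maximum if $R\neq0$). A vector $m$ of an $R$-module is unimodular if some linear functional takes the value $1$ on it. The stable rank $sr(R)$ is the smallest $n$ such that for every unimodular $(r_0,\dots,r_n)\in R^{n+1}$ there are $t_0,\dots,t_{n-1}\in R$ with $(r_0+t_0r_n,\dots,r_{n-1}+t_{n-1}r_n)\in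 R^n$ unimodular. The unitary stable rank $usr(R)$ is the smallest $n\ge sr(R)$ such that the elementary symplectic group $ESp_{2n+2}(R)$ (the subgroup of $Sp_{2n+2}(R)$ generated by the elementary symplectic matrices) acts transitively on the unimodular vectors of $R^{2n+2}$. Either rank is $\infty$ if no such $n$ exists. **Theorem (general cancellation).** Let $(M_1,\lambda_1,\partial_1)$ and $(M_2,\lambda_2,\partial_2)$ be formed spaces with boundary over $R$ with $\partial_1$ and $\partial_2$ surjective, such that $$(M_1,\lambda_1,\partial_1)\#X\cong(M_2,\lambda_2,\partial_2)\#X.$$ If $g_X(M_1,\lambda_1,\partial_1)\ge 2\,usr(R)+5$, then $(M_1,\lambda_1,\partial_1)\cong(M_2,\lambda_2,\partial_2)$. -/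

import Mathlib

universe u v w

/-- A formed space with boundary `(M, lam, bd)` over `R`: a finitely generated free module with an
alternating bilinear form and a linear functional. -/
structure FormedSpaceBdry (R : Type u) [CommRing R] where
  carrier : Type v
  [addCommGroup : AddCommGroup carrier]
  [module : Module R carrier]
  [free : Module.Free R carrier]
  [finite : Module.Finite R carrier]
  form : carrier →ₗ[R] carrier →ₗ[R] R
  form_self : ∀ x, form x x = 0
  bdry : carrier →ₗ[R] R

namespace FormedSpaceBdry

attribute [instance] FormedSpaceBdry.addCommGroup FormedSpaceBdry.module FormedSpaceBdry.free
  FormedSpaceBdry.finite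

variable {R : Type u} [CommRing R]

/-- Isomorphism of formed spaces with boundary: a linear equivalence preserving the form and the
boundary functional. -/
def Isomorphic (M : FormedSpaceBdry.{u, v} R) (N : FormedSpaceBdry.{u, w} R) : Prop :=
  ∃ e : M.carrier ≃ₗ[R] N.carrier,
    (∀ x y, N.form (e x) (e y) = M.form x y) ∧ ∀ x, N.bdry (e x) = M.bdry x

/-- The form on the direct sum of the modules of `M` and `N` with block matrix
`[[lam_M, bd_M^T bd_N], [-bd_N^T bd_M, lam_N]]`. -/
def sumForm (M : FormedSpaceBdry.{u, v} R) (N : FormedSpaceBdry.{u, w} R) :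
    (M.carrier × N.carrier) →ₗ[R] (M.carrier × N.carrier) →ₗ[R] R :=
  M.form.compl₁₂ (LinearMap.fst R _ _) (LinearMap.fst R _ _)
    + (LinearMap.mul R R).compl₁₂
        (M.bdry ∘ₗ LinearMap.fst R _ _) (N.bdry ∘ₗ LinearMap.snd R _ _)
    - (LinearMap.mul R R).compl₁₂
        (N.bdry ∘ₗ LinearMap.snd R _ _) (M.bdry ∘ₗ LinearMap.fst R _ _)
    + N.form.compl₁₂ (LinearMap.snd R _ _) (LinearMap.snd R _ _)

theorem sumForm_apply (M : FormedSpaceBdry.{u, v} R) (N : FormedSpaceBdry.{u, w} R)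
    (x y : M.carrier × N.carrier) :
    sumForm M N x y
      = M.form x.1 y.1 + M.bdry x.1 * N.bdry y.2 - N.bdry x.2 * M.bdry y.1 + N.form x.2 y.2 := by
  simp [sumForm]

/-- The monoidal sum `M # N`. -/
abbrev sum (M : FormedSpaceBdry.{u, v} R) (N : FormedSpaceBdry.{u, w} R) :
    FormedSpaceBdry.{u, max v w} R where
  carrier := M.carrier × N.carrier
  form := sumForm M N
  form_self x := by
    rw [sumForm_apply, M.form_self, N.form_self]
    ring
  bdry := M.bdry ∘ₗ LinearMap.fst R _ _ + N.bdry ∘ₗ LinearMap.snd R _ _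

variable (R) in
/-- The monoidal unit `(0, 0, 0)`. -/
abbrev zero : FormedSpaceBdry.{u, u} R where
  carrier := PUnit.{u + 1}
  form := 0
  form_self _ := rfl
  bdry := 0

variable (R) in
/-- The object `X = (R, 0, id)`. -/
abbrev X : FormedSpaceBdry.{u, u} R where
  carrier := R
  form := 0
  form_self _ := rfl
  bdry := LinearMap.id

variable (R) in
/-- The iterated sum `X # ... # X` with `g` summands. -/
def Xpow : ℕ → FormedSpaceBdry.{u, u} R
  | 0 => zero R
  | g + 1 => (Xpow g).sum (X R)

/-- The arc genus `g_X(M)`: the largest `g` such that `M` is isomorphic to `N # X^{#g}` for some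
formed space with boundary `N`. -/
noncomputable def arcGenus (M : FormedSpaceBdry.{u, v} R) : ℕ∞ :=
  sSup ((fun g : ℕ => (g : ℕ∞)) ''
    {g : ℕ | ∃ N : FormedSpaceBdry.{u, v} R, M.Isomorphic (N.sum (Xpow R g))})

end FormedSpaceBdry

/-- A vector `m` is unimodular if some linear functional takes the value `1` on it. -/
def IsUnimodular (R : Type u) [CommRing R] {M : Type v} [AddCommGroup M] [Module R M] (m : M) :
    Prop :=
  ∃ φ : M →ₗ[R] R, φ m = 1

/-- The stable range condition `(S_n)`; the last entry of the vector of length `n + 1` is `r`. -/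
def StableRangeCondition (R : Type u) [CommRing R] (n : ℕ) : Prop :=
  ∀ (a : Fin n → R) (r : R), IsUnimodular R (Fin.snoc a r : Fin (n + 1) → R) →
    ∃ t : Fin n → R, IsUnimodular R (fun i => a i + t i * r)

/-- The stable rank `sr(R)`, equal to `⊤` if no `(S_n)` holds. -/
noncomputable def stableRank (R : Type u) [CommRing R] : ℕ∞ :=
  sInf ((fun n : ℕ => (n : ℕ∞)) '' {n : ℕ | StableRangeCondition R n})

namespace ElementarySymplectic

variable {R : Type u} [CommRing R] {l : Type} [DecidableEq l]

/-- The elementary symmetric matrix with entry `r` at `(i, j)` and `(j, i)`. -/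
def symSingle (i j : l) (r : R) : Matrix l l R :=
  if i = j then Matrix.single i i r else Matrix.single i j r + Matrix.single j i r

theorem symSingle_transpose (i j : l) (r : R) : (symSingle i j r).transpose = symSingle i j r := by
  unfold symSingle
  split_ifs with h
  · simp
  · simp [add_comm]

variable [Fintype l]

/-- The elementary symplectic matrix with `symSingle i j r` in the upper right block. -/
def upper (i j : l) (r : R) : Matrix.symplecticGroup l R :=
  ⟨Matrix.fromBlocks 1 (symSingle i j r) 0 1, by
    rw [SymplecticGroup.mem_iff, Matrix.J, Matrix.fromBlocks_transpose,
      Matrix.fromBlocks_multiply, Matrix.fromBlocks_multiply, symSingle_transpose]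
    simp⟩

/-- The elementary symplectic matrix with `symSingle i j r` in the lower left block. -/
def lower (i j : l) (r : R) : Matrix.symplecticGroup l R :=
  ⟨Matrix.fromBlocks 1 0 (symSingle i j r) 1, by
    rw [SymplecticGroup.mem_iff, Matrix.J, Matrix.fromBlocks_transpose,
      Matrix.fromBlocks_multiply, Matrix.fromBlocks_multiply, symSingle_transpose]
    simp⟩

/-- The elementary symplectic matrix with `1 + r E_{ij}` in the upper left block and the inverse
transpose `1 - r E_{ji}` in the lower right block (`i ≠ j`). -/
def diag (i j : l) (hij : i ≠ j) (r : R) : Matrix.symplecticGroup l R :=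
  ⟨Matrix.fromBlocks (Matrix.transvection i j r) 0 0 (Matrix.transvection j i (-r)), by
    have h1 : Matrix.transvection i j r * Matrix.transvection i j (-r) = 1 := by
      rw [Matrix.transvection_mul_transvection_same _ _ hij, add_neg_cancel,
        Matrix.transvection_zero]
    have h2 : Matrix.transvection j i (-r) * Matrix.transvection j i r = 1 := by
      rw [Matrix.transvection_mul_transvection_same _ _ hij.symm, neg_add_cancel,
        Matrix.transvection_zero]
    have t1 : ∀ (a b : l) (s : R),
        (Matrix.transvection a b s).transpose = Matrix.transvection b a s := by
      intro a b s
      simp [Matrix.transvection]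
    rw [SymplecticGroup.mem_iff, Matrix.J, Matrix.fromBlocks_transpose,
      Matrix.fromBlocks_multiply, Matrix.fromBlocks_multiply, t1, t1]
    simp [h1, h2]⟩

end ElementarySymplectic

open ElementarySymplectic in
/-- The elementary symplectic group `ESp_{2g}(R)`. -/
def elementarySymplecticGroup (g : ℕ) (R : Type u) [CommRing R] :
    Subgroup (Matrix.symplecticGroup (Fin g) R) :=
  Subgroup.closure
    ({A | ∃ (i j : Fin g) (r : R), A = upper i j r}
      ∪ {A | ∃ (i j : Fin g) (r : R), A = lower i j r}
      ∪ {A | ∃ (i j : Fin g) (hij : i ≠ j) (r : R), A = diag i j hij r})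

/-- `ESp_{2g}(R)` acts transitively on the unimodular vectors of `R^{2g}`. -/
def ElementarySymplecticTransitive (g : ℕ) (R : Type u) [CommRing R] : Prop :=
  ∀ x y : Fin g ⊕ Fin g → R, IsUnimodular R x → IsUnimodular R y →
    ∃ A ∈ elementarySymplecticGroup g R,
      Matrix.mulVec (A : Matrix (Fin g ⊕ Fin g) (Fin g ⊕ Fin g) R) x = y

/-- The unitary stable rank `usr(R)`: the least `n ≥ sr(R)` such that `ESp_{2n+2}(R)` acts
transitively on the unimodular vectors of `R^{2n+2}`, and `⊤` if there is none. -/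
noncomputable def unitaryStableRank (R : Type u) [CommRing R] : ℕ∞ :=
  sInf ((fun n : ℕ => (n : ℕ∞)) ''
    {n : ℕ | stableRank R ≤ (n : ℕ∞) ∧ ElementarySymplecticTransitive (n + 1) R})

/-!
In a formed space with boundary `V`, the ways of splitting off a copy of `X` on the right are given
by the vectors `x` with `∂ x = 1`: the complementary summand is the kernel of `∂ - λ(-, x)`. An
isomorphism `M₁ # X ≅ M₂ # X` therefore yields two such vectors in the single space `V = M₁ # X`,
and `M₁ ≅ M₂` follows as soon as an automorphism of `V` carries one to the other
(`FormedSpaceBdry.isomorphic_of_sum_X`). Surjectivity of the boundary of the complement means that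
`λ(-, x)` still takes the value `1` on `ker ∂`.

The transitivity (`FormedSpaceBdry.HyperbolicFamily.sameOrbit`) needs only `usr(R) + 1` mutually
orthogonal hyperbolic pairs `eᵢ, fᵢ` in `ker ∂`; they exist because `X^{#(2h+1)}` contains `h` of
them (`FormedSpaceBdry.exists_hyperbolicFamily_Xpow`). Let `H` be the span of the pairs. The stable
range condition and an Eichler transformation make the `H`-component of `x` unimodular; a symplectic
matrix acting on `H` then moves this component to `e₀`, so that `λ(x, f₀) = 1`. Finally, if
`λ(x, f) = λ(y, f) = 1` for some `f ∈ ker ∂` and `∂ x = ∂ y`, the Eichler transformation attached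
to `y - x` and `f` carries `x` to `y`.

If `usr(R) = ∞`, the arc genus is infinite, which the rank of `M₁` forbids over a nontrivial ring.
-/

/-! ### Stable range conditions -/

theorem isUnimodular_pi_iff {R : Type u} [CommRing R] {ι : Type} [Fintype ι] [DecidableEq ι]
    (z : ι → R) : IsUnimodular R z ↔ ∃ c : ι → R, ∑ i, c i * z i = 1 := by
  constructor
  · rintro ⟨φ, hφ⟩
    refine ⟨fun i => φ (Pi.single i 1), ?_⟩
    refine Eq.trans (Finset.sum_congr rfl fun i _ => ?_)
      ((LinearMap.pi_apply_eq_sum_univ φ z).symm.trans hφ)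
    have hi : (Pi.single i 1 : ι → R) = fun j => if i = j then 1 else 0 := by
      funext j
      simp [Pi.single_apply, eq_comm]
    simp only [hi, smul_eq_mul, mul_comm]
  · rintro ⟨c, hc⟩
    exact ⟨∑ i, c i • LinearMap.proj i, by simpa using hc⟩

theorem StableRangeCondition.succ {R : Type u} [CommRing R] {n : ℕ}
    (h : StableRangeCondition R n) : StableRangeCondition R (n + 1) := by
  intro a r hu
  obtain ⟨c, hc⟩ := (isUnimodular_pi_iff _).1 hu
  rw [Fin.sum_univ_castSucc, Fin.sum_univ_castSucc] at hc
  simp only [Fin.snoc_castSucc, Fin.snoc_last] at hc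
  -- The last two entries `p, r` are merged into the single entry `s = c p + d r`.
  set p := a (Fin.last n) with hp
  set s := c (Fin.last n).castSucc * p + c (Fin.last (n + 1)) * r with hs
  obtain ⟨t, ht⟩ := h (fun i => a i.castSucc) s ((isUnimodular_pi_iff _).2
    ⟨Fin.snoc (fun i => c i.castSucc.castSucc) 1, by
      rw [Fin.sum_univ_castSucc]
      simp only [Fin.snoc_castSucc, Fin.snoc_last]
      rw [one_mul, hs, ← add_assoc, hc]⟩)
  obtain ⟨d, hd⟩ := (isUnimodular_pi_iff _).1 ht
  refine ⟨Fin.snoc (fun i => t i * c (Fin.last (n + 1))) 0, (isUnimodular_pi_iff _).2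
    ⟨Fin.snoc d (∑ i, d i * t i * c (Fin.last n).castSucc), ?_⟩⟩
  rw [Fin.sum_univ_castSucc]
  simp only [Fin.snoc_castSucc, Fin.snoc_last]
  rw [← hd, ← hp, Finset.sum_mul, ← Finset.sum_add_distrib]
  refine Finset.sum_congr rfl fun i _ => ?_
  rw [hs]
  ring

theorem StableRangeCondition.mono {R : Type u} [CommRing R] {m n : ℕ} (hmn : m ≤ n)
    (h : StableRangeCondition R m) : StableRangeCondition R n := by
  induction n, hmn using Nat.le_induction with
  | base => exact h
  | succ n _ ih => exact ih.succ

theorem stableRangeCondition_of_stableRank_le {R : Type u} [CommRing R] {n : ℕ}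
    (h : stableRank R ≤ n) : StableRangeCondition R n := by
  have hlt : stableRank R < ((n + 1 : ℕ) : ℕ∞) :=
    h.trans_lt (by exact_mod_cast Nat.lt_succ_self n)
  obtain ⟨_, ⟨k, hk, rfl⟩, hkn⟩ := sInf_lt_iff.1 hlt
  have hkn' : k < n + 1 := Nat.cast_lt.1 hkn
  exact StableRangeCondition.mono (Nat.lt_succ_iff.1 hkn') hk

/-- The stable range condition for vectors indexed by an arbitrary finite type. -/
theorem StableRangeCondition.exists_isUnimodular {R : Type u} [CommRing R] {ι : Type} [Fintype ι]
    [DecidableEq ι] (h : StableRangeCondition R (Fintype.card ι)) (z : ι → R) (r : R)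
    (c : ι → R) (d : R) (hcd : ∑ i, c i * z i + d * r = 1) :
    ∃ t : ι → R, IsUnimodular R (fun i => z i + t i * r) := by
  let σ := Fintype.equivFin ι
  obtain ⟨t, ht⟩ := h (fun i => z (σ.symm i)) r ((isUnimodular_pi_iff _).2
    ⟨Fin.snoc (fun i => c (σ.symm i)) d, by
      rw [Fin.sum_univ_castSucc]
      simp only [Fin.snoc_castSucc, Fin.snoc_last]
      rw [← hcd, Equiv.sum_comp σ.symm (fun i => c i * z i)]⟩)
  obtain ⟨b, hb⟩ := (isUnimodular_pi_iff _).1 ht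
  refine ⟨fun i => t (σ i), (isUnimodular_pi_iff _).2 ⟨fun i => b (σ i), ?_⟩⟩
  rw [← hb, ← Equiv.sum_comp σ]
  simp

namespace FormedSpaceBdry

variable {R : Type u} [CommRing R]

/-! ### Automorphisms -/

theorem form_swap (V : FormedSpaceBdry.{u, v} R) (x y : V.carrier) :
    V.form x y = -V.form y x := by
  have h := V.form_self (x + y)
  simp only [map_add, LinearMap.add_apply, V.form_self, zero_add, add_zero] at h
  linear_combination h

/-- Two vectors are in the same orbit if an automorphism of the formed space with boundary carries
one to the other. -/
def SameOrbit (V : FormedSpaceBdry.{u, v} R) (x y : V.carrier) : Prop :=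
  ∃ φ : V.carrier ≃ₗ[R] V.carrier,
    (∀ a b, V.form (φ a) (φ b) = V.form a b) ∧ (∀ a, V.bdry (φ a) = V.bdry a) ∧ φ x = y

theorem SameOrbit.symm {V : FormedSpaceBdry.{u, v} R} {x y : V.carrier} (h : V.SameOrbit x y) :
    V.SameOrbit y x := by
  obtain ⟨φ, h1, h2, rfl⟩ := h
  exact ⟨φ.symm, fun a b => by rw [← h1]; simp, fun a => by rw [← h2]; simp, by simp⟩

theorem SameOrbit.trans {V : FormedSpaceBdry.{u, v} R} {x y z : V.carrier}
    (h : V.SameOrbit x y) (h' : V.SameOrbit y z) : V.SameOrbit x z := by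
  obtain ⟨φ, h1, h2, rfl⟩ := h
  obtain ⟨ψ, k1, k2, rfl⟩ := h'
  exact ⟨φ.trans ψ, fun a b => by simp [h1, k1], fun a => by simp [h2, k2], by simp⟩

/-- The pairing `λ(-, x)` takes the value `1` on the kernel of the boundary. If `∂ x = 1`, this
says that the complement of `x`, the kernel of `∂ - λ(-, x)`, has surjective boundary. -/
def PairsToOne (V : FormedSpaceBdry.{u, v} R) (x : V.carrier) : Prop :=
  ∃ u, V.bdry u = 0 ∧ V.form u x = 1

theorem SameOrbit.bdry_eq {V : FormedSpaceBdry.{u, v} R} {x y : V.carrier}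
    (h : V.SameOrbit x y) : V.bdry x = V.bdry y := by
  obtain ⟨φ, -, h2, rfl⟩ := h
  exact (h2 x).symm

/-- The Eichler transformation `w ↦ w + λ(w, u) v + λ(w, v) u + a λ(w, v) v`. It is defined for
all `u` and `v`, but preserves the form only under a condition such as `λ(u, v) = 0`. -/
def eichler (V : FormedSpaceBdry.{u, v} R) (u v : V.carrier) (a : R) :
    V.carrier →ₗ[R] V.carrier :=
  LinearMap.id + (V.form.flip u).smulRight v + (V.form.flip v).smulRight u
    + (a • V.form.flip v).smulRight v

theorem eichler_apply (V : FormedSpaceBdry.{u, v} R) (u v w : V.carrier) (a : R) :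
    V.eichler u v a w
      = w + V.form w u • v + V.form w v • u + (a * V.form w v) • v := by
  simp [eichler]

theorem eichler_neg_eichler (V : FormedSpaceBdry.{u, v} R) {u v : V.carrier}
    (huv : V.form u v = 0) (a : R) (w : V.carrier) :
    V.eichler (-u) v (-a) (V.eichler u v a w) = w := by
  have hvu : V.form v u = 0 := by rw [form_swap, huv, neg_zero]
  simp only [eichler_apply, map_add, map_smul, map_neg, V.form_self, huv, hvu, mul_zero]
  module

/-- For orthogonal `u, v` in the kernel of the boundary, the Eichler transformation is an
automorphism. -/
theorem sameOrbit_eichler (V : FormedSpaceBdry.{u, v} R) {u v : V.carrier}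
    (huv : V.form u v = 0) (hu : V.bdry u = 0) (hv : V.bdry v = 0) (a : R) (x : V.carrier) :
    V.SameOrbit x (V.eichler u v a x) := by
  have hvu : V.form v u = 0 := by rw [form_swap, huv, neg_zero]
  refine ⟨LinearEquiv.ofLinearMap (V.eichler u v a) (V.eichler (-u) v (-a)) ?_ ?_, ?_, ?_, rfl⟩
  · ext w
    have h := V.eichler_neg_eichler (u := -u) (v := v) (by simp [huv]) (-a) w
    simpa using h
  · ext w
    exact V.eichler_neg_eichler huv a w
  · intro b c
    rw [LinearEquiv.coe_ofLinearMap]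
    simp only [eichler_apply, map_add, map_smul, LinearMap.add_apply, LinearMap.smul_apply,
      V.form_self, huv, hvu, smul_eq_mul, mul_zero, add_zero]
    rw [V.form_swap u c, V.form_swap v c]
    ring
  · intro b
    simp [eichler_apply, hu, hv]

theorem sameOrbit_of_form_eq_one (V : FormedSpaceBdry.{u, v} R) {x y f : V.carrier}
    (hf : V.bdry f = 0) (hx : V.form x f = 1) (hy : V.form y f = 1) (hxy : V.bdry x = V.bdry y) :
    V.SameOrbit x y := by
  have h := V.sameOrbit_eichler (u := y - x) (v := f) (by simp [hx, hy]) (by simp [hxy]) hf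
    (-V.form x (y - x)) x
  have e : V.eichler (y - x) f (-V.form x (y - x)) x = y := by
    rw [eichler_apply, hx]
    module
  rwa [e] at h

/-! ### Hyperbolic families -/

theorem form_sum_X (V : FormedSpaceBdry.{u, v} R) (x y : V.carrier × R) :
    (V.sum (X R)).form x y = V.form x.1 y.1 + V.bdry x.1 * y.2 - x.2 * V.bdry y.1 :=
  (sumForm_apply V (X R) x y).trans (add_zero _)

theorem form_sum_X_sum_X (V : FormedSpaceBdry.{u, v} R) (a a' : V.carrier) (b b' c c' : R) :
    (V.sum (X R)).sumForm (X R) ((a, b), c) ((a', b'), c')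
      = V.form a a' + V.bdry a * b' - b * V.bdry a'
        + (V.bdry a + b) * c' - c * (V.bdry a' + b') := by
  have h1 := V.form_sum_X (a, b) (a', b')
  have h2 : (V.sum (X R)).sumForm (X R) ((a, b), c) ((a', b'), c')
      = (V.sum (X R)).form (a, b) (a', b') + (V.bdry a + b) * c' - c * (V.bdry a' + b') :=
    (V.sum (X R)).form_sum_X ((a, b), c) ((a', b'), c')
  linear_combination h1 + h2

/-- A family of `h` mutually orthogonal hyperbolic pairs in the kernel of the boundary. -/
structure HyperbolicFamily (V : FormedSpaceBdry.{u, v} R) (h : ℕ) where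
  e : Fin h → V.carrier
  f : Fin h → V.carrier
  form_e_e : ∀ i j, V.form (e i) (e j) = 0
  form_f_f : ∀ i j, V.form (f i) (f j) = 0
  form_e_f : ∀ i j, V.form (e i) (f j) = if i = j then 1 else 0
  bdry_e : ∀ i, V.bdry (e i) = 0
  bdry_f : ∀ i, V.bdry (f i) = 0

namespace HyperbolicFamily

variable {V : FormedSpaceBdry.{u, v} R} {h : ℕ}

/-- The image of a hyperbolic family under a linear map preserving form and boundary. -/
def map {W : FormedSpaceBdry.{u, w} R} (B : V.HyperbolicFamily h) (L : V.carrier →ₗ[R] W.carrier)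
    (h1 : ∀ x y, W.form (L x) (L y) = V.form x y) (h2 : ∀ x, W.bdry (L x) = V.bdry x) :
    W.HyperbolicFamily h where
  e i := L (B.e i)
  f i := L (B.f i)
  form_e_e i j := by rw [h1, B.form_e_e]
  form_f_f i j := by rw [h1, B.form_f_f]
  form_e_f i j := by rw [h1, B.form_e_f]
  bdry_e i := by rw [h2, B.bdry_e]
  bdry_f i := by rw [h2, B.bdry_f]

variable (B : V.HyperbolicFamily h)

theorem form_f_e (i j : Fin h) : V.form (B.f i) (B.e j) = if i = j then -1 else 0 := by
  rw [form_swap, B.form_e_f]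
  split_ifs <;> simp_all

/-- The inclusion of the standard symplectic module spanned by the family. -/
def incl : (Fin h ⊕ Fin h → R) →ₗ[R] V.carrier :=
  ∑ i, (LinearMap.proj (Sum.inl i)).smulRight (B.e i)
    + ∑ i, (LinearMap.proj (Sum.inr i)).smulRight (B.f i)

theorem incl_apply (z : Fin h ⊕ Fin h → R) :
    B.incl z = ∑ i, z (Sum.inl i) • B.e i + ∑ i, z (Sum.inr i) • B.f i := by
  simp [incl]

/-- The coordinates, with respect to the family, of the orthogonal projection onto its span. -/
def coord : V.carrier →ₗ[R] (Fin h ⊕ Fin h → R) :=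
  LinearMap.pi (Sum.elim (fun i => V.form.flip (B.f i)) (fun i => -V.form.flip (B.e i)))

@[simp]
theorem coord_inl (x : V.carrier) (i : Fin h) : B.coord x (Sum.inl i) = V.form x (B.f i) := rfl

@[simp]
theorem coord_inr (x : V.carrier) (i : Fin h) : B.coord x (Sum.inr i) = -V.form x (B.e i) := rfl

theorem coord_incl (z : Fin h ⊕ Fin h → R) : B.coord (B.incl z) = z := by
  ext (i | i) <;>
  simp [incl_apply, B.form_e_e, B.form_e_f, B.form_f_e, B.form_f_f]

theorem bdry_incl (z : Fin h ⊕ Fin h → R) : V.bdry (B.incl z) = 0 := by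
  simp [incl_apply, B.bdry_e, B.bdry_f]

theorem form_incl_right (x : V.carrier) (z : Fin h ⊕ Fin h → R) :
    V.form x (B.incl z)
      = B.coord x ⬝ᵥ Matrix.mulVec (-Matrix.J (Fin h) R) z := by
  simp [incl_apply, Matrix.J, Matrix.neg_mulVec, dotProduct, Matrix.fromBlocks_mulVec,
    mul_comm, add_comm]

theorem form_incl_left (x : V.carrier) (z : Fin h ⊕ Fin h → R) :
    V.form (B.incl z) x = z ⬝ᵥ Matrix.mulVec (-Matrix.J (Fin h) R) (B.coord x) := by
  simp [incl_apply, Matrix.J, Matrix.neg_mulVec, dotProduct, Matrix.fromBlocks_mulVec,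
    V.form_swap x, add_comm]

/-- The action of a matrix on the span of the family, extended by the identity on the orthogonal
complement. -/
def act (A : Matrix (Fin h ⊕ Fin h) (Fin h ⊕ Fin h) R) : V.carrier →ₗ[R] V.carrier :=
  LinearMap.id - B.incl ∘ₗ B.coord + B.incl ∘ₗ A.mulVecLin ∘ₗ B.coord

theorem act_apply (A : Matrix (Fin h ⊕ Fin h) (Fin h ⊕ Fin h) R) (x : V.carrier) :
    B.act A x = x - B.incl (B.coord x) + B.incl (A.mulVec (B.coord x)) := by
  simp [act]

theorem coord_act (A : Matrix (Fin h ⊕ Fin h) (Fin h ⊕ Fin h) R) (x : V.carrier) :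
    B.coord (B.act A x) = A.mulVec (B.coord x) := by
  simp [act_apply, coord_incl]

theorem act_act_of_mul_eq_one {A C : Matrix (Fin h ⊕ Fin h) (Fin h ⊕ Fin h) R} (hAC : A * C = 1)
    (x : V.carrier) : B.act A (B.act C x) = x := by
  rw [B.act_apply A, coord_act, act_apply, Matrix.mulVec_mulVec, hAC, Matrix.one_mulVec]
  abel

theorem sameOrbit_act (A : Matrix.symplecticGroup (Fin h) R) (x : V.carrier) :
    V.SameOrbit x (B.act A x) := by
  have hA : (A : Matrix (Fin h ⊕ Fin h) (Fin h ⊕ Fin h) R).transpose * Matrix.J (Fin h) R * A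
      = Matrix.J (Fin h) R := SymplecticGroup.mem_iff'.1 A.2
  have h1 : (A : Matrix (Fin h ⊕ Fin h) (Fin h ⊕ Fin h) R) * (A⁻¹ : Matrix.symplecticGroup _ R)
      = 1 := by
    rw [← Submonoid.coe_mul, mul_inv_cancel]; rfl
  have h2 : ((A⁻¹ : Matrix.symplecticGroup _ R) : Matrix (Fin h ⊕ Fin h) (Fin h ⊕ Fin h) R) * A
      = 1 := by
    rw [← Submonoid.coe_mul, inv_mul_cancel]; rfl
  refine ⟨LinearEquiv.ofLinearMap (B.act A) (B.act (A⁻¹ : Matrix.symplecticGroup _ R)) ?_ ?_,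
    ?_, ?_, rfl⟩
  · ext w
    exact B.act_act_of_mul_eq_one h1 w
  · ext w
    exact B.act_act_of_mul_eq_one h2 w
  · intro b c
    rw [LinearEquiv.coe_ofLinearMap, act_apply, act_apply]
    have key : (A.1.mulVec (B.coord b)) ⬝ᵥ
        (-Matrix.J (Fin h) R).mulVec (A.1.mulVec (B.coord c))
          = B.coord b ⬝ᵥ (-Matrix.J (Fin h) R).mulVec (B.coord c) := by
      rw [← Matrix.vecMul_transpose, ← Matrix.dotProduct_mulVec, Matrix.mulVec_mulVec,
        Matrix.mulVec_mulVec, Matrix.mul_neg, Matrix.neg_mul, ← hA]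
      simp [hA]
    simp only [map_add, map_sub, LinearMap.add_apply, LinearMap.sub_apply, form_incl_left,
      coord_incl]
    simp only [form_incl_right, key]
    ring
  · intro b
    simp [act_apply, bdry_incl]

/-- The stable range condition makes the coordinates of a vector unimodular, up to
automorphisms. -/
theorem exists_sameOrbit_isUnimodular_coord (hS : StableRangeCondition R (h + h)) {x : V.carrier}
    (hx : V.PairsToOne x) : ∃ y, V.SameOrbit x y ∧ IsUnimodular R (B.coord y) := by
  obtain ⟨u, hu0, hu1⟩ := hx
  -- The component of `u` orthogonal to the family.
  set p := u - B.incl (B.coord u) with hp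
  have hcp : B.coord p = 0 := by simp [hp, coord_incl]
  have hpx : V.form p x + V.form (B.incl (B.coord u)) x = 1 := by
    rw [← hu1, hp]; simp
  obtain ⟨t, ht⟩ := StableRangeCondition.exists_isUnimodular (ι := Fin h ⊕ Fin h)
    (by simpa using hS) (B.coord x) (V.form x p)
    (Matrix.vecMul (B.coord u) (-Matrix.J (Fin h) R)) (-1) (by
      rw [form_incl_left, Matrix.dotProduct_mulVec, V.form_swap p x, dotProduct] at hpx
      linear_combination hpx)
  refine ⟨V.eichler p (B.incl t) 0 x, V.sameOrbit_eichler ?_ ?_ (B.bdry_incl t) 0 x, ?_⟩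
  · rw [form_incl_right, hcp, zero_dotProduct]
  · simp [hp, bdry_incl, hu0]
  · convert ht using 1
    ext i
    simp [eichler_apply, hcp, coord_incl, mul_comm]

/-- Vectors of equal boundary whose pairing takes the value `1` on the kernel of the boundary form
a single orbit. -/
theorem sameOrbit {n : ℕ} (B : V.HyperbolicFamily (n + 1))
    (hS : StableRangeCondition R (n + 1 + (n + 1))) (hT : ElementarySymplecticTransitive (n + 1) R)
    {x y : V.carrier} (hx : V.PairsToOne x) (hy : V.PairsToOne y) (hxy : V.bdry x = V.bdry y) :
    V.SameOrbit x y := by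
  have key : ∀ {x : V.carrier}, V.PairsToOne x →
      ∃ y, V.SameOrbit x y ∧ V.form y (B.f 0) = 1 := by
    intro x hx
    obtain ⟨z, hxz, hz⟩ := B.exists_sameOrbit_isUnimodular_coord hS hx
    obtain ⟨A, -, hA⟩ := hT (B.coord z) (Pi.single (Sum.inl 0) 1) hz
      ⟨LinearMap.proj (Sum.inl 0), by simp⟩
    refine ⟨B.act A z, hxz.trans (B.sameOrbit_act A z), ?_⟩
    rw [← coord_inl, coord_act, hA, Pi.single_eq_same]
  obtain ⟨x', hxx, hx'⟩ := key hx
  obtain ⟨y', hyy, hy'⟩ := key hy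
  refine (hxx.trans (V.sameOrbit_of_form_eq_one (B.bdry_f 0) hx' hy' ?_)).trans hyy.symm
  rw [← hxx.bdry_eq, ← hyy.bdry_eq, hxy]

/-- A hyperbolic family orthogonal to a vector `r` of boundary `1` grows by one pair after adding
two copies of `X` with generators `p` and `q`: the new pair is `p - r, q - r`, and `r - p + q` has
boundary `1` and is orthogonal to the enlarged family. -/
theorem exists_succ (r : V.carrier) (hr : V.bdry r = 1) (hre : ∀ i, V.form r (B.e i) = 0)
    (hrf : ∀ i, V.form r (B.f i) = 0) :
    ∃ (C : ((V.sum (X R)).sum (X R)).HyperbolicFamily (h + 1))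
      (s : (V.carrier × R) × R), ((V.sum (X R)).sum (X R)).bdry s = 1 ∧
      (∀ i, ((V.sum (X R)).sum (X R)).form s (C.e i) = 0) ∧
      ∀ i, ((V.sum (X R)).sum (X R)).form s (C.f i) = 0 := by
  have her : ∀ i, V.form (B.e i) r = 0 := fun i => by rw [form_swap, hre, neg_zero]
  have hfr : ∀ i, V.form (B.f i) r = 0 := fun i => by rw [form_swap, hrf, neg_zero]
  refine ⟨{
      e := Fin.cons ((-r, 1), 0) fun i => ((B.e i, 0), 0)
      f := Fin.cons ((-r, 0), 1) fun i => ((B.f i, 0), 0)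
      form_e_e := ?_
      form_f_f := ?_
      form_e_f := ?_
      bdry_e := ?_
      bdry_f := ?_ }, ((r, -1), 1), ?_, ?_, ?_⟩
  · intro i j
    cases i using Fin.cases <;> cases j using Fin.cases <;>
    exact (form_sum_X_sum_X V _ _ _ _ _ _).trans (by
      simp [her, hre, B.form_e_e, V.form_self, B.bdry_e, hr])
  · intro i j
    cases i using Fin.cases <;> cases j using Fin.cases <;>
    exact (form_sum_X_sum_X V _ _ _ _ _ _).trans (by
      simp [hfr, hrf, B.form_f_f, V.form_self, B.bdry_f, hr])
  · intro i j
    cases i using Fin.cases <;> cases j using Fin.cases <;>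
    exact (form_sum_X_sum_X V _ _ _ _ _ _).trans (by
      simp [her, hrf, B.form_e_f, V.form_self, B.bdry_e, B.bdry_f, hr,
        Fin.succ_ne_zero, (Fin.succ_ne_zero _).symm])
  · intro i
    cases i using Fin.cases <;> simp [B.bdry_e, hr]
  · intro i
    cases i using Fin.cases <;> simp [B.bdry_f, hr]
  · simp [hr]
  · intro i
    cases i using Fin.cases <;>
    exact (form_sum_X_sum_X V _ _ _ _ _ _).trans (by
      simp [hre, V.form_self, B.bdry_e, hr])
  · intro i
    cases i using Fin.cases <;>
    exact (form_sum_X_sum_X V _ _ _ _ _ _).trans (by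
      simp [hrf, V.form_self, B.bdry_f, hr])

end HyperbolicFamily

theorem exists_hyperbolicFamily_Xpow (h : ℕ) :
    ∃ (B : (Xpow R (2 * h + 1)).HyperbolicFamily h) (r : (Xpow R (2 * h + 1)).carrier),
      (Xpow R (2 * h + 1)).bdry r = 1 ∧ (∀ i, (Xpow R (2 * h + 1)).form r (B.e i) = 0) ∧
      ∀ i, (Xpow R (2 * h + 1)).form r (B.f i) = 0 := by
  induction h with
  | zero =>
    refine ⟨⟨Fin.elim0, Fin.elim0, nofun, nofun, nofun, nofun, nofun⟩,
      ((0 : (Xpow R 0).carrier), (1 : R)), ?_, nofun, nofun⟩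
    change (Xpow R 0).bdry 0 + (1 : R) = 1
    simp
  | succ h ih =>
    obtain ⟨B, r, hr, he, hf⟩ := ih
    exact B.exists_succ r hr he hf

theorem nonempty_hyperbolicFamily_Xpow {h g : ℕ} (hg : 2 * h + 1 ≤ g) :
    Nonempty ((Xpow R g).HyperbolicFamily h) := by
  induction g, hg using Nat.le_induction with
  | base => exact ⟨(exists_hyperbolicFamily_Xpow h).choose⟩
  | succ g _ ih =>
    obtain ⟨B⟩ := ih
    exact ⟨B.map (W := (Xpow R g).sum (X R)) (LinearMap.inl R _ _)
      (fun x y => (form_sum_X _ _ _).trans (by simp)) (fun x => by simp)⟩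

/-! ### Arc genus -/

theorem exists_isomorphic_of_le_arcGenus {M : FormedSpaceBdry.{u, v} R} {k : ℕ}
    (hk : ((k + 1 : ℕ) : ℕ∞) ≤ M.arcGenus) :
    ∃ (g : ℕ) (N : FormedSpaceBdry.{u, v} R), k + 1 ≤ g ∧
      M.Isomorphic (N.sum (Xpow R g)) := by
  have hlt : ((k : ℕ) : ℕ∞) < M.arcGenus :=
    lt_of_lt_of_le (by exact_mod_cast Nat.lt_succ_self k) hk
  obtain ⟨_, ⟨g, ⟨N, hN⟩, rfl⟩, hg⟩ := lt_sSup_iff.1 hlt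
  exact ⟨g, N, Nat.cast_lt.1 hg, hN⟩

theorem nonempty_hyperbolicFamily_of_le_arcGenus {M : FormedSpaceBdry.{u, v} R} {h : ℕ}
    (hg : ((2 * h + 1 : ℕ) : ℕ∞) ≤ M.arcGenus) : Nonempty (M.HyperbolicFamily h) := by
  obtain ⟨g, N, hgk, φ, h1, h2⟩ := exists_isomorphic_of_le_arcGenus hg
  obtain ⟨B⟩ := nonempty_hyperbolicFamily_Xpow (R := R) hgk
  refine ⟨(B.map (W := N.sum (Xpow R g)) (LinearMap.inr R _ _)
    (fun x y => by simp [sumForm_apply]) (fun x => by simp)).map φ.symm.toLinearMap ?_ ?_⟩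
  · intro x y
    rw [← h1]; simp
  · intro x
    rw [← h2]; simp

theorem finrank_Xpow [Nontrivial R] (g : ℕ) : Module.finrank R (Xpow R g).carrier = g := by
  induction g with
  | zero => exact Module.finrank_zero_of_subsingleton (M := PUnit.{u + 1})
  | succ g ih =>
    change Module.finrank R ((Xpow R g).carrier × R) = g + 1
    rw [Module.finrank_prod, ih, Module.finrank_self]

theorem arcGenus_le_finrank [Nontrivial R] (M : FormedSpaceBdry.{u, v} R) :
    M.arcGenus ≤ Module.finrank R M.carrier := by
  refine sSup_le ?_
  rintro _ ⟨g, ⟨N, φ, -, -⟩, rfl⟩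
  have h : Module.finrank R M.carrier = Module.finrank R (N.carrier × (Xpow R g).carrier) :=
    φ.finrank_eq
  rw [Module.finrank_prod, finrank_Xpow] at h
  exact Nat.cast_le.2 (by omega)

/-! ### Cancellation -/

/-- An isomorphism `M₁ # X ≅ M₂ # X` matching the generators of the two copies of `X` restricts to
`M₁ ≅ M₂`, since `Mᵢ` is the set of `v` with `λ(v, x) = ∂ v` for the generator `x`. -/
theorem isomorphic_of_sum_X {M₁ : FormedSpaceBdry.{u, v} R} {M₂ : FormedSpaceBdry.{u, w} R}
    (φ : (M₁.carrier × R) ≃ₗ[R] (M₂.carrier × R))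
    (h1 : ∀ x y, (M₂.sum (X R)).form (φ x) (φ y) = (M₁.sum (X R)).form x y)
    (h2 : ∀ x, (M₂.sum (X R)).bdry (φ x) = (M₁.sum (X R)).bdry x)
    (hφ : φ (0, 1) = (0, 1)) : M₁.Isomorphic M₂ := by
  have hs : ∀ m, (φ (m, 0)).2 = 0 := by
    intro m
    have a1 := h1 (m, 0) (0, 1)
    have a2 := h2 (m, 0)
    rw [hφ] at a1
    rw [form_sum_X, form_sum_X] at a1
    simp at a1 a2
    linear_combination a2 - a1
  have hφ' : φ.symm (0, 1) = (0, 1) := by rw [← hφ, φ.symm_apply_apply]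
  have hs' : ∀ m, (φ.symm (m, 0)).2 = 0 := by
    intro m
    have a1 := h1 (φ.symm (m, 0)) (φ.symm (0, 1))
    have a2 := h2 (φ.symm (m, 0))
    rw [φ.apply_symm_apply, φ.apply_symm_apply, hφ'] at a1
    rw [φ.apply_symm_apply] at a2
    rw [form_sum_X, form_sum_X] at a1
    simp at a1 a2
    linear_combination a1 - a2
  have e1 : ∀ m, φ (m, 0) = ((φ (m, 0)).1, 0) := fun m => Prod.ext rfl (hs m)
  have e2 : ∀ m, φ.symm (m, 0) = ((φ.symm (m, 0)).1, 0) := fun m => Prod.ext rfl (hs' m)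
  refine ⟨LinearEquiv.ofLinearMap
    (LinearMap.fst R M₂.carrier R ∘ₗ φ.toLinearMap ∘ₗ LinearMap.inl R M₁.carrier R)
    (LinearMap.fst R M₁.carrier R ∘ₗ φ.symm.toLinearMap ∘ₗ LinearMap.inl R M₂.carrier R)
    ?_ ?_, ?_, ?_⟩
  · ext m
    simp [← e2]
  · ext m
    simp [← e1]
  · intro x y
    have a1 := h1 (x, 0) (y, 0)
    rw [e1 x, e1 y] at a1
    rw [form_sum_X, form_sum_X] at a1
    simpa using a1
  · intro x
    have a2 := h2 (x, 0)
    rw [e1 x] at a2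
    simpa using a2

theorem pairsToOne_sum_X {M : FormedSpaceBdry.{u, v} R} (hM : Function.Surjective M.bdry) :
    (M.sum (X R)).PairsToOne (0, 1) := by
  obtain ⟨m, hm⟩ := hM 1
  exact ⟨(m, -1), by simp [hm], (form_sum_X _ _ _).trans (by simp [hm])⟩

end FormedSpaceBdry

theorem unitaryStableRank_eq_natCast {R : Type u} [CommRing R] {n : ℕ}
    (h : unitaryStableRank R = n) :
    StableRangeCondition R n ∧ ElementarySymplecticTransitive (n + 1) R := by
  have hlt : unitaryStableRank R < ⊤ := h ▸ ENat.natCast_lt_top n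
  have hne : ((fun n : ℕ => (n : ℕ∞)) ''
      {n : ℕ | stableRank R ≤ (n : ℕ∞) ∧ ElementarySymplecticTransitive (n + 1) R}).Nonempty := by
    obtain ⟨a, ha, -⟩ := sInf_lt_iff.1 hlt
    exact ⟨a, ha⟩
  obtain ⟨m, ⟨h1, h2⟩, hm⟩ := csInf_mem hne
  have hmn : m = n := by
    have : (m : ℕ∞) = n := hm.trans h
    exact_mod_cast this
  subst hmn
  exact ⟨stableRangeCondition_of_stableRank_le h1, h2⟩

theorem mainTheorem7 {R : Type u} [CommRing R]
    (M₁ : FormedSpaceBdry.{u, v} R) (M₂ : FormedSpaceBdry.{u, w} R)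
    (hM₁ : Function.Surjective M₁.bdry) (hM₂ : Function.Surjective M₂.bdry)
    (hX : FormedSpaceBdry.Isomorphic
      (M₁.sum (FormedSpaceBdry.X R)) (M₂.sum (FormedSpaceBdry.X R)))
    (hg : 2 * unitaryStableRank R + 5 ≤ M₁.arcGenus) :
    FormedSpaceBdry.Isomorphic M₁ M₂ := by
  rcases subsingleton_or_nontrivial R with hR | hR
  · have := Module.subsingleton R M₁.carrier
    have := Module.subsingleton R M₂.carrier
    exact ⟨0, fun _ _ => Subsingleton.elim _ _, fun _ => Subsingleton.elim _ _⟩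
  -- An infinite unitary stable rank would force the arc genus above the rank of `M₁`.
  obtain ⟨n, hn⟩ : ∃ n : ℕ, unitaryStableRank R = n := by
    refine ENat.ne_top_iff_exists.1 (fun htop => ?_) |>.imp fun _ h => h.symm
    rw [htop, ENat.mul_top (by norm_num), top_add] at hg
    exact absurd (hg.trans M₁.arcGenus_le_finrank) (not_le.2 (ENat.natCast_lt_top _))
  obtain ⟨hS, hT⟩ := unitaryStableRank_eq_natCast hn
  rw [hn] at hg
  obtain ⟨B₁⟩ := FormedSpaceBdry.nonempty_hyperbolicFamily_of_le_arcGenus (M := M₁) (h := n + 1)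
    (le_trans (by exact_mod_cast (by omega : 2 * (n + 1) + 1 ≤ 2 * n + 5)) hg)
  let B := B₁.map (W := M₁.sum (FormedSpaceBdry.X R)) (LinearMap.inl R _ _)
    (fun x y => (FormedSpaceBdry.form_sum_X _ _ _).trans (by simp)) (fun x => by simp)
  obtain ⟨ψ, h1, h2⟩ := hX
  obtain ⟨u, hu0, hu1⟩ := FormedSpaceBdry.pairsToOne_sum_X hM₂
  obtain ⟨φ, k1, k2, hφ⟩ := B.sameOrbit (hS.mono (by omega)) hT
    (FormedSpaceBdry.pairsToOne_sum_X hM₁) (y := ψ.symm (0, 1))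
    ⟨ψ.symm u, by rw [← h2, ψ.apply_symm_apply, hu0],
      by rw [← h1, ψ.apply_symm_apply, ψ.apply_symm_apply, hu1]⟩
    (by rw [← h2 (ψ.symm _), ψ.apply_symm_apply]; simp)
  exact FormedSpaceBdry.isomorphic_of_sum_X (φ.trans ψ)
    (fun x y => (h1 _ _).trans (k1 x y)) (fun x => (h2 _).trans (k2 x))
    (by rw [LinearEquiv.trans_apply, hφ, ψ.apply_symm_apply])
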